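/- Let $I=[0,1]$. For a closed set $K\subseteq I$ and a subset $A\subseteq K$, let \[K_A=(K\times\{0\})\cup(A\times\{1\}),\] ordered by the restriction of the lexicographic order of $[0,1]\times\{0,1\}$ and equipped with the order topology. The weight of a topological space is the least cardinality of a base of its topology. Theorem. For every infinite cardinal number $\kappa\le 2^{\omega}$ there is a family $\mathcal F$ of pairs $(K,A)$, with $K\subseteq I$ closed and $A\subseteq K$, such that $|\mathcal F|=2^{\kappa}$, for every $(K,A)\in\mathcal F$ the linearly ordered space $K_A$ is compact, separable and of weight $\kappa$, and for distinct pairs $(K,A),(L,B)\in\mathcal F$ the spaces $K_A$ and $L_B$ are not homeomorphic. -/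

import Mathlib

open Cardinal TopologicalSpace

/-- The weight of a topological space: the least cardinality of a base of its topology. -/
noncomputable def topWeight (X : Type*) [TopologicalSpace X] : Cardinal :=
  sInf {c | ∃ B : Set (Set X), IsTopologicalBasis B ∧ #B = c}

/-- The set `K × {0} ∪ A × {1}` inside `[0,1] × {0,1}` with the lexicographic order. -/
def splitSet (K A : Set unitInterval) : Set (unitInterval ×ₗ Fin 2) :=
  {x | ofLex x ∈ K ×ˢ {0} ∪ A ×ˢ {1}}

/-- The space `K_A`, that is `K × {0} ∪ A × {1}` with (the restriction of) the lexicographic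
order and with its own order topology. -/
def SplitLine (K A : Set unitInterval) : Type := splitSet K A

noncomputable instance (K A : Set unitInterval) : LinearOrder (SplitLine K A) :=
  inferInstanceAs (LinearOrder (splitSet K A))

noncomputable instance (K A : Set unitInterval) : TopologicalSpace (SplitLine K A) :=
  Preorder.topology (SplitLine K A)

instance (K A : Set unitInterval) : OrderTopology (SplitLine K A) := ⟨rfl⟩

/-! `K_A` is `K` with every point of `A` doubled. The projection to `K` and, for each `a ∈ A`, the
side of the jump at `a` embed it as a closed subset of `I × 2^A`. Hence it is compact, and for
infinite `A` its weight is `#A`: the jumps bound it below, the coordinates above. It is separable if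
`A ⊆ (h, 1)` and `[h, 1] ⊆ K`. To get `2 ^ κ` homeomorphism types, compare `2 ^ κ` with `2 ^ ℵ₀`.

If `2 ^ ℵ₀ < 2 ^ κ`, take `K = I` and count. `A` is the set of values that the projection takes
twice, so a homeomorphic copy `K_B` of a fixed `K_A` determines a continuous map `K_A → I` from
which `B` is recovered. A separable space has at most `2 ^ ℵ₀` such maps, so each homeomorphism
class is small, while there are `2 ^ κ` sets `A` of size `κ`.

Otherwise `2 ^ κ = 2 ^ ℵ₀`. Fix `A ⊆ (h, 1)` of size `κ` and let `K = C_S ∪ [h, 1]`, where `S ⊆ ℕ`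
and `C_S ⊆ [0, h)` is a Cantor set with scattered pieces of rank `n ∈ S` attached. The part over
`[h, 1]` has no isolated points, so the local Cantor–Bendixson ranks, and with them `S`, are read
off from `K_A`. -/

open Set Filter Topology

/-! ### Order, topology and compactness of `K_A` -/

namespace SplitLine

variable {K A : Set unitInterval}

/-- The projection of `K_A` to the unit interval. -/
def proj (x : SplitLine K A) : unitInterval := (ofLex x.1).1

/-- The point `(t, 0)` of `K_A`. -/
def lo (t : unitInterval) (ht : t ∈ K) : SplitLine K A := ⟨toLex (t, 0), Or.inl ⟨ht, rfl⟩⟩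

/-- The point `(t, 1)` of `K_A`. -/
def hi (t : unitInterval) (ht : t ∈ A) : SplitLine K A := ⟨toLex (t, 1), Or.inr ⟨ht, rfl⟩⟩

@[simp] theorem proj_lo (t : unitInterval) (ht : t ∈ K) : proj (lo t ht : SplitLine K A) = t := rfl

@[simp] theorem proj_hi (t : unitInterval) (ht : t ∈ A) : proj (hi t ht : SplitLine K A) = t := rfl

theorem eq_lo_or_eq_hi (x : SplitLine K A) :
    (∃ h : proj x ∈ K, x = lo (proj x) h) ∨ ∃ h : proj x ∈ A, x = hi (proj x) h := by
  obtain ⟨x, h | h⟩ := x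
  · refine Or.inl ⟨h.1, Subtype.ext ?_⟩
    exact congrArg toLex (Prod.ext rfl h.2)
  · refine Or.inr ⟨h.1, Subtype.ext ?_⟩
    exact congrArg toLex (Prod.ext rfl h.2)

theorem proj_mem (hA : A ⊆ K) (x : SplitLine K A) : proj x ∈ K := by
  rcases eq_lo_or_eq_hi x with ⟨h, -⟩ | ⟨h, -⟩
  exacts [h, hA h]

theorem le_iff (x y : SplitLine K A) :
    x ≤ y ↔ proj x < proj y ∨ proj x = proj y ∧ (ofLex x.1).2 ≤ (ofLex y.1).2 :=
  Prod.Lex.le_iff (x := x.1) (y := y.1)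

theorem lt_iff (x y : SplitLine K A) :
    x < y ↔ proj x < proj y ∨ proj x = proj y ∧ (ofLex x.1).2 < (ofLex y.1).2 :=
  Prod.Lex.lt_iff (x := x.1) (y := y.1)

theorem proj_mono : Monotone (proj : SplitLine K A → unitInterval) := by
  intro x y h
  rcases (le_iff x y).1 h with h | h
  exacts [h.le, h.1.le]

theorem lt_lo_iff (x : SplitLine K A) (t : unitInterval) (ht : t ∈ K) :
    x < lo t ht ↔ proj x < t := by
  rw [lt_iff]
  simp [lo, proj]

theorem lo_le_iff (x : SplitLine K A) (t : unitInterval) (ht : t ∈ K) :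
    lo t ht ≤ x ↔ t ≤ proj x := by
  rw [← not_lt, lt_lo_iff, not_lt]

theorem hi_lt_iff (x : SplitLine K A) (t : unitInterval) (ht : t ∈ A) :
    hi t ht < x ↔ t < proj x := by
  rw [lt_iff]
  simp only [hi, proj, ofLex_toLex]
  have : ¬ (1 : Fin 2) < (ofLex x.1).2 := by omega
  simp [this]

theorem lo_lt_iff_hi_le (x : SplitLine K A) (t : unitInterval) (ht : t ∈ A) (hK : t ∈ K) :
    lo t hK < x ↔ hi t ht ≤ x := by
  rw [lt_iff, le_iff]
  simp only [lo, hi, proj, ofLex_toLex]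
  have : (0 : Fin 2) < (ofLex x.1).2 ↔ 1 ≤ (ofLex x.1).2 := by omega
  rw [this]

theorem lo_lt_iff (x : SplitLine K A) (t : unitInterval) (ht : t ∉ A) (hK : t ∈ K) :
    lo t hK < x ↔ t < proj x := by
  refine ⟨fun h => lt_of_le_of_ne (proj_mono h.le) fun e => ?_, fun h => (lt_iff _ _).2 (Or.inl h)⟩
  rcases eq_lo_or_eq_hi x with ⟨h1, h2⟩ | ⟨h1, -⟩
  · have : x = lo t hK := by rw [h2]; congr 1; exact e.symm
    exact h.ne this.symm
  · exact ht (by rw [show t = proj x from e]; exact h1)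

/-- The coordinates of a point: its projection, and the side of each jump on which it lies. -/
noncomputable def coords (hA : A ⊆ K) (x : SplitLine K A) : unitInterval × (A → Bool) :=
  (proj x, fun a => decide (x ≤ lo a.1 (hA a.2)))

theorem isOpen_proj_gt_of_mem {t : unitInterval} (ht : t ∈ K) :
    IsOpen {x : SplitLine K A | t < proj x} := by
  by_cases h : t ∈ A
  · convert isOpen_Ioi (a := (hi t h : SplitLine K A)) using 1
    ext x; simp [hi_lt_iff]
  · convert isOpen_Ioi (a := (lo t ht : SplitLine K A)) using 1
    ext x; simp [lo_lt_iff x t h ht]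

/-- Since `K` is closed, a threshold `t ∉ K` can be replaced by the nearest point of `K` on the
appropriate side, and preimages of rays become rays. -/
theorem continuous_proj (hK : IsClosed K) (hA : A ⊆ K) :
    Continuous (proj : SplitLine K A → unitInterval) := by
  rw [OrderTopology.topology_eq_generate_intervals (α := unitInterval)]
  refine continuous_generateFrom_iff.2 ?_
  rintro _ ⟨t, rfl | rfl⟩
  · by_cases hne : (K ∩ Iic t).Nonempty
    · have hm := (hK.inter isClosed_Iic).isCompact.sSup_mem hne
      convert isOpen_proj_gt_of_mem hm.1 using 1
      ext x
      rw [mem_preimage, mem_Ioi, mem_ofPred_eq]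
      refine ⟨fun h => lt_of_le_of_lt hm.2 h, fun h => ?_⟩
      by_contra hc
      exact absurd h (not_lt.2 (le_csSup (OrderTop.bddAbove _)
        ⟨proj_mem hA x, mem_Iic.2 (not_lt.1 hc)⟩))
    · convert isOpen_univ
      refine eq_univ_of_forall fun x => ?_
      by_contra hc
      exact hne ⟨proj x, proj_mem hA x, mem_Iic.2 (not_lt.1 hc)⟩
  · by_cases hne : (K ∩ Ici t).Nonempty
    · have hm := (hK.inter isClosed_Ici).isCompact.sInf_mem hne
      convert isOpen_Iio (a := (lo _ hm.1 : SplitLine K A)) using 1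
      ext x
      rw [mem_preimage, mem_Iio, mem_Iio, lt_lo_iff]
      refine ⟨fun h => lt_of_lt_of_le h hm.2, fun h => ?_⟩
      by_contra hc
      exact absurd h (not_lt.2 (csInf_le (OrderBot.bddBelow _)
        ⟨proj_mem hA x, mem_Ici.2 (not_lt.1 hc)⟩))
    · convert isOpen_univ
      refine eq_univ_of_forall fun x => ?_
      by_contra hc
      exact hne ⟨proj x, proj_mem hA x, mem_Ici.2 (not_lt.1 hc)⟩

theorem compl_Iic_lo (t : unitInterval) (ht : t ∈ A) (hK : t ∈ K) :
    (Iic (lo t hK : SplitLine K A))ᶜ = Ici (hi t ht) := by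
  ext x
  simp [lo_lt_iff_hi_le x t ht hK]

theorem isClopen_Iic_lo (t : unitInterval) (ht : t ∈ A) (hK : t ∈ K) :
    IsClopen (Iic (lo t hK : SplitLine K A)) := by
  refine ⟨isClosed_Iic, ?_⟩
  rw [← isClosed_compl_iff, compl_Iic_lo t ht hK]
  exact isClosed_Ici

theorem continuous_coords (hK : IsClosed K) (hA : A ⊆ K) :
    Continuous (coords hA : SplitLine K A → _) := by
  refine (continuous_proj hK hA).prodMk (continuous_pi fun a => ?_)
  refine continuous_bool_rng true |>.2 ?_
  convert isClopen_Iic_lo a.1 a.2 (hA a.2) using 1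
  ext x; simp

/-- Every open ray is the preimage of a coordinate condition: a side of a jump if the ray ends
inside a jump, a ray of `I` otherwise. -/
theorem isInducing_coords (hK : IsClosed K) (hA : A ⊆ K) :
    IsInducing (coords hA : SplitLine K A → _) := by
  have hp (t : unitInterval) : IsOpen[induced (coords hA : SplitLine K A → _) inferInstance]
      {x : SplitLine K A | t < proj x} :=
    isOpen_induced_iff.2 ⟨Prod.fst ⁻¹' Ioi t, isOpen_Ioi.preimage continuous_fst, rfl⟩
  have hq (t : unitInterval) : IsOpen[induced (coords hA : SplitLine K A → _) inferInstance]
      {x : SplitLine K A | proj x < t} :=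
    isOpen_induced_iff.2 ⟨Prod.fst ⁻¹' Iio t, isOpen_Iio.preimage continuous_fst, rfl⟩
  have hc (a : A) (b : Bool) : IsOpen[induced (coords hA : SplitLine K A → _) inferInstance]
      {x : SplitLine K A | decide (x ≤ lo a.1 (hA a.2)) = b} :=
    isOpen_induced_iff.2 ⟨(fun p => p.2 a) ⁻¹' {b}, (isOpen_discrete {b}).preimage (by fun_prop), rfl⟩
  refine ⟨le_antisymm (continuous_coords hK hA).le_induced ?_⟩
  rw [OrderTopology.topology_eq_generate_intervals (α := SplitLine K A)]
  refine le_generateFrom ?_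
  rintro _ ⟨x, rfl | rfl⟩
  · rcases eq_lo_or_eq_hi x with ⟨h, e⟩ | ⟨h, e⟩
    · by_cases hx : proj x ∈ A
      · convert hc ⟨_, hx⟩ false using 1
        ext y
        have := lt_iff_not_ge (a := lo _ h) (b := y)
        rw [← e] at this
        rw [mem_Ioi, this, mem_ofPred_eq, decide_eq_false_iff_not]
        exact not_congr (iff_of_eq (congrArg (y ≤ ·) e))
      · convert hp (proj x) using 1
        ext y
        rw [mem_Ioi, mem_ofPred_eq, ← lo_lt_iff y _ hx h, ← e]
    · convert hp (proj x) using 1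
      ext y
      rw [mem_Ioi, mem_ofPred_eq, ← hi_lt_iff y _ h, ← e]
  · rcases eq_lo_or_eq_hi x with ⟨h, e⟩ | ⟨h, e⟩
    · convert hq (proj x) using 1
      ext y
      rw [mem_Iio, mem_ofPred_eq, ← lt_lo_iff y _ h, ← e]
    · convert hc ⟨_, h⟩ true using 1
      ext y
      have := lo_lt_iff_hi_le y _ h (hA h)
      rw [← e] at this
      rw [mem_Iio, mem_ofPred_eq, decide_eq_true_iff, ← not_le, ← this, not_lt]

theorem coords_injective (hA : A ⊆ K) :
    Function.Injective (coords hA : SplitLine K A → _) := by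
  intro x y h
  have h1 : proj x = proj y := (Prod.ext_iff.1 h).1
  have h2 : ∀ a : A, (x ≤ lo a.1 (hA a.2) ↔ y ≤ lo a.1 (hA a.2)) := fun a => by
    simpa [coords] using congrFun (Prod.ext_iff.1 h).2 a
  rcases lt_trichotomy x y with hxy | rfl | hxy
  · exfalso
    rcases eq_lo_or_eq_hi y with ⟨h3, e⟩ | ⟨h3, e⟩
    · rw [e, lt_lo_iff] at hxy
      exact hxy.ne h1
    · have := h2 ⟨_, h3⟩
      rw [← not_lt, ← not_lt, lo_lt_iff_hi_le _ _ h3, lo_lt_iff_hi_le _ _ h3, ← e] at this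
      exact absurd hxy (by simpa using this)
  · rfl
  · exfalso
    rcases eq_lo_or_eq_hi x with ⟨h3, e⟩ | ⟨h3, e⟩
    · rw [e, lt_lo_iff] at hxy
      exact hxy.ne h1.symm
    · have := h2 ⟨_, h3⟩
      rw [← not_lt, ← not_lt, lo_lt_iff_hi_le _ _ h3, lo_lt_iff_hi_le _ _ h3, ← e] at this
      exact absurd hxy (by simpa using this)

/-- The bit at `a` is forced by `t` unless `t = a`, where both values occur, for `(a, 0)` and `(a,
1)`. Written this way, the image is visibly closed. -/
theorem range_coords (hA : A ⊆ K) :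
    range (coords hA : SplitLine K A → _) = {p | p.1 ∈ K} ∩
      ⋂ a : A, (({p | p.2 a = true} ∩ {p | p.1 ≤ a.1}) ∪ ({p | p.2 a = false} ∩ {p | a.1 ≤ p.1})) := by
  ext p
  constructor
  · rintro ⟨x, rfl⟩
    refine ⟨proj_mem hA x, mem_iInter.2 fun a => ?_⟩
    simp only [coords, mem_union, mem_inter_iff, mem_ofPred_eq, decide_eq_true_iff,
      decide_eq_false_iff_not, not_le]
    rcases le_or_gt x (lo a.1 (hA a.2)) with h | h
    · exact Or.inl ⟨h, proj_mono h⟩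
    · exact Or.inr ⟨h, proj_mono h.le⟩
  · obtain ⟨t, g⟩ := p
    rintro ⟨ht, hg⟩
    simp only [mem_iInter, mem_union, mem_inter_iff, mem_ofPred_eq] at hg ht
    by_cases h : ∃ h : t ∈ A, g ⟨t, h⟩ = false
    · obtain ⟨h, hgt⟩ := h
      refine ⟨hi t h, Prod.ext rfl (funext fun a => ?_)⟩
      rcases hg a with h1 | h1
      · have hne : t ≠ a := by
          rintro rfl
          simp [h1.1] at hgt
        refine Eq.trans ?_ h1.1.symm
        simpa [coords] using (le_iff (hi t h) (lo a.1 (hA a.2))).2 (Or.inl (lt_of_le_of_ne h1.2 hne))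
      · refine Eq.trans ?_ h1.1.symm
        exact decide_eq_false (not_le.2 ((lo_lt_iff_hi_le _ _ a.2 _).2 ((le_iff _ _).2
          ((lt_or_eq_of_le h1.2).imp_right fun e => ⟨e, le_rfl⟩))))
    · push Not at h
      refine ⟨lo t ht, Prod.ext rfl (funext fun a => ?_)⟩
      rcases hg a with h1 | h1
      · refine Eq.trans ?_ h1.1.symm
        simpa [coords, lo_le_iff] using h1.2
      · have hne : a ≠ t := by
          rintro rfl
          exact h a.2 h1.1
        refine Eq.trans ?_ h1.1.symm
        simpa [coords, lt_lo_iff] using lt_of_le_of_ne h1.2 hne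

theorem isClosedEmbedding_coords (hK : IsClosed K) (hA : A ⊆ K) :
    IsClosedEmbedding (coords hA : SplitLine K A → _) := by
  refine ⟨⟨isInducing_coords hK hA, coords_injective hA⟩, ?_⟩
  rw [range_coords]
  have hb (a : A) (b : Bool) : IsClosed {p : unitInterval × (A → Bool) | p.2 a = b} :=
    isClosed_eq (by fun_prop) continuous_const
  exact (hK.preimage continuous_fst).inter (isClosed_iInter fun a =>
    ((hb a true).inter (isClosed_le continuous_fst continuous_const)).union
      ((hb a false).inter (isClosed_le continuous_const continuous_fst)))

theorem compactSpace (hK : IsClosed K) (hA : A ⊆ K) : CompactSpace (SplitLine K A) :=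
  (isClosedEmbedding_coords hK hA).compactSpace

theorem nhds_eq_comap_proj (hK : IsClosed K) (hA : A ⊆ K) {x : SplitLine K A}
    (hx : proj x ∉ A) : 𝓝 x = comap proj (𝓝 (proj x)) := by
  apply le_antisymm (continuous_proj hK hA).continuousAt.tendsto.le_comap
  obtain ⟨h, e⟩ := (eq_lo_or_eq_hi x).resolve_right fun h => hx h.1
  refine tendsto_id'.1 (tendsto_order.2 ⟨fun b hb => ?_, fun b hb => ?_⟩)
  · rw [e, lt_lo_iff] at hb
    exact ⟨Ioi (proj b), Ioi_mem_nhds hb, fun z hz => (lt_iff _ _).2 (Or.inl hz)⟩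
  · rw [gt_iff_lt, e, lo_lt_iff _ _ hx] at hb
    exact ⟨Iio (proj b), Iio_mem_nhds hb, fun z hz => (lt_iff _ _).2 (Or.inl hz)⟩

end SplitLine

/-! ### Weight and separability -/

namespace SplitLine

variable {K A : Set unitInterval}

/-- The ray up to `(a, 0)` is open, so some basic set has `(a, 0)` as its maximum; different `a`
need different basic sets. -/
theorem mk_le_of_isTopologicalBasis (hA : A ⊆ K) {B : Set (Set (SplitLine K A))}
    (hB : IsTopologicalBasis B) : #A ≤ #B := by
  have h (a : A) : ∃ U ∈ B, lo a.1 (hA a.2) ∈ U ∧ U ⊆ Iic (lo a.1 (hA a.2)) :=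
    hB.mem_nhds_iff.1 ((isClopen_Iic_lo a.1 a.2 (hA a.2)).isOpen.mem_nhds self_mem_Iic)
  choose U hU hm hs using h
  refine mk_le_of_injective (f := fun a => (⟨U a, hU a⟩ : B)) fun a b hab => ?_
  have hab : U a = U b := Subtype.ext_iff.1 hab
  have h1 : lo a.1 (hA a.2) ≤ (lo b.1 (hA b.2) : SplitLine K A) := hs b (hab ▸ hm a)
  have h2 : lo b.1 (hA b.2) ≤ (lo a.1 (hA a.2) : SplitLine K A) := hs a (hab.symm ▸ hm b)
  exact Subtype.ext (le_antisymm (proj_mono h1) (proj_mono h2))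

/-- A subbase of `K_A`: preimages of a countable base of the interval and sides of jumps. -/
noncomputable def subbase (hA : A ⊆ K) :
    countableBasis unitInterval ⊕ A × Bool → Set (SplitLine K A)
  | .inl V => proj ⁻¹' V.1
  | .inr p => {x | decide (x ≤ lo p.1.1 (hA p.1.2)) = p.2}

theorem eq_generateFrom_subbase (hK : IsClosed K) (hA : A ⊆ K) :
    (inferInstance : TopologicalSpace (SplitLine K A)) = generateFrom (range (subbase hA)) := by
  refine le_antisymm (le_generateFrom ?_) ?_
  · rintro _ ⟨V | p, rfl⟩
    · exact (isOpen_of_mem_countableBasis V.2).preimage (continuous_proj hK hA)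
    · exact (isOpen_discrete {p.2}).preimage
        ((continuous_apply p.1).comp (continuous_snd.comp (continuous_coords hK hA)))
  · rw [(isInducing_coords hK hA).eq_induced, ← continuous_iff_le_induced]
    let _ : TopologicalSpace (SplitLine K A) := generateFrom (range (subbase hA))
    have h1 : Continuous (proj : SplitLine K A → unitInterval) :=
      (isBasis_countableBasis unitInterval).continuous_iff.2 fun V hV =>
        isOpen_generateFrom_of_mem ⟨.inl ⟨V, hV⟩, rfl⟩
    have h2 (a : A) : Continuous fun x : SplitLine K A => decide (x ≤ lo a.1 (hA a.2)) :=
      continuous_discrete_rng.2 fun b => isOpen_generateFrom_of_mem ⟨.inr ⟨a, b⟩, rfl⟩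
    exact h1.prodMk (continuous_pi h2)

theorem topWeight_eq (hK : IsClosed K) (hA : A ⊆ K) (hinf : ℵ₀ ≤ #A) :
    topWeight (SplitLine K A) = #A := by
  refine le_antisymm ?_ (le_csInf ?_ ?_)
  · have hb := isTopologicalBasis_of_subbasis (eq_generateFrom_subbase hK hA)
    refine (csInf_le (OrderBot.bddBelow _) (mem_ofPred.2 ⟨_, hb, rfl⟩)).trans ?_
    have hJ : #(countableBasis unitInterval ⊕ A × Bool) = #A := by
      rw [mk_sum, mk_prod, lift_id, lift_id, lift_id, lift_id, mk_bool]
      have h2 : #A * 2 = #A := mul_eq_left hinf (natCast_lt_aleph0.le.trans hinf) (by simp)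
      rw [h2]
      exact add_eq_right hinf ((countable_countableBasis unitInterval).le_aleph0.trans hinf)
    have : Infinite (countableBasis unitInterval ⊕ A × Bool) := by
      rw [infinite_iff, hJ]; exact hinf
    rw [← hJ, ← mk_finset_of_infinite (countableBasis unitInterval ⊕ A × Bool)]
    -- The base of finite intersections is indexed by finite sets of indices, of which there are
    -- only `#A`.
    have hsub : ((fun f => ⋂₀ f) '' {f | f.Finite ∧ f ⊆ range (subbase hA)}) ⊆
        range fun F : Finset (countableBasis unitInterval ⊕ A × Bool) =>
          ⋂₀ (subbase hA '' (F : Set _)) := by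
      rintro _ ⟨f, ⟨hf, hfs⟩, rfl⟩
      obtain ⟨G, hG, rfl⟩ := subset_range_iff_exists_image_eq.1 hfs
      obtain ⟨H, -, e⟩ := exists_subset_bijOn G (subbase hA)
      have hHf : H.Finite := by
        rw [← e.image_eq] at hf
        exact hf.of_finite_image e.injOn
      refine ⟨hHf.toFinset, ?_⟩
      simp only [Finite.coe_toFinset, e.image_eq]
    exact (mk_le_mk_of_subset hsub).trans mk_range_le
  · exact ⟨_, _, isTopologicalBasis_opens, rfl⟩
  · rintro _ ⟨B, hB, rfl⟩
    exact mk_le_of_isTopologicalBasis hA hB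

/-- Every nonempty open subset of `K_A` contains the preimage of a nonempty open subset of `K`,
if `A` lies in the interior of an interval `[h, 1]` contained in `K`. -/
theorem exists_proj_preimage_subset (hK : IsClosed K) (hA : A ⊆ K) {h : unitInterval}
    (hhK : Ici h ⊆ K) (hhA : A ⊆ Ioo h 1) {V : Set (SplitLine K A)} (hV : IsOpen V)
    (hne : V.Nonempty) :
    ∃ W : Set unitInterval, IsOpen W ∧ (W ∩ K).Nonempty ∧ proj ⁻¹' W ⊆ V := by
  obtain ⟨x, hx⟩ := hne
  have hn : V ∈ 𝓝 x := hV.mem_nhds hx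
  by_cases hxA : proj x ∈ A
  · have hIoo := hhA hxA
    rcases eq_lo_or_eq_hi x with ⟨h1, e⟩ | ⟨h1, e⟩
    · have hlo : (lo h (hhK self_mem_Ici) : SplitLine K A) < x := by
        rw [lt_iff]; exact Or.inl hIoo.1
      obtain ⟨y, hy, hyO⟩ := exists_Ioc_subset_of_mem_nhds hn ⟨_, hlo⟩
      rw [e, lt_lo_iff] at hy
      -- Neighbourhoods of `(a, 0)` extend to the left only; cutting at `h` keeps the interval
      -- inside `K`.
      refine ⟨Ioo (max h (proj y)) (proj x), isOpen_Ioo, ?_, fun z hz => hyO ⟨?_, ?_⟩⟩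
      · obtain ⟨z, hz⟩ := nonempty_Ioo.2 (max_lt hIoo.1 hy)
        exact ⟨z, hz, hhK ((le_max_left _ _).trans hz.1.le)⟩
      · exact (lt_iff _ _).2 (Or.inl ((le_max_right _ _).trans_lt hz.1))
      · exact (le_iff _ _).2 (Or.inl hz.2)
    · have hlo : x < (lo 1 (hhK (mem_Ici.2 (hIoo.1.trans hIoo.2).le)) : SplitLine K A) := by
        rw [lt_iff]; exact Or.inl hIoo.2
      obtain ⟨y, hy, hyO⟩ := exists_Ico_subset_of_mem_nhds hn ⟨_, hlo⟩
      rw [e, hi_lt_iff] at hy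
      refine ⟨Ioo (proj x) (proj y), isOpen_Ioo, ?_, fun z hz => hyO ⟨?_, ?_⟩⟩
      · obtain ⟨z, hz⟩ := nonempty_Ioo.2 hy
        exact ⟨z, hz, hhK (hIoo.1.le.trans hz.1.le)⟩
      · exact (le_iff _ _).2 (Or.inl hz.1)
      · exact (lt_iff _ _).2 (Or.inl hz.2)
  · rw [nhds_eq_comap_proj hK hA hxA, ((nhds_basis_opens _).comap _).mem_iff] at hn
    obtain ⟨W, ⟨h1, h2⟩, h3⟩ := hn
    exact ⟨W, h2, ⟨_, h1, proj_mem hA x⟩, h3⟩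

theorem separableSpace (hK : IsClosed K) (hA : A ⊆ K) {h : unitInterval}
    (hhK : Ici h ⊆ K) (hhA : A ⊆ Ioo h 1) : SeparableSpace (SplitLine K A) := by
  obtain ⟨c, hc, hcd⟩ := exists_countable_dense K
  refine ⟨(fun t : K => (lo t.1 t.2 : SplitLine K A)) '' c, hc.image _, ?_⟩
  rw [dense_iff_inter_open]
  intro V hV hne
  obtain ⟨W, hW, ⟨t, htW, htK⟩, hWV⟩ := exists_proj_preimage_subset hK hA hhK hhA hV hne
  obtain ⟨s, hs, hsc⟩ := hcd.inter_open_nonempty (Subtype.val ⁻¹' W)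
    (hW.preimage continuous_subtype_val) ⟨⟨t, htK⟩, htW⟩
  exact ⟨_, hWV (show s.1 ∈ W from hs), s, hsc, rfl⟩

end SplitLine

/-! ### Counting homeomorphism classes: the case `2 ^ ℵ₀ < 2 ^ κ` -/

namespace SplitLine

variable {K A : Set unitInterval}

theorem mem_iff_exists_ne (hA : A ⊆ K) (t : unitInterval) :
    t ∈ A ↔ ∃ x y : SplitLine K A, x ≠ y ∧ proj x = t ∧ proj y = t := by
  constructor
  · intro h
    refine ⟨lo t (hA h), hi t h, fun e => ?_, rfl, rfl⟩
    have := lo_lt_iff_hi_le (K := K) (hi t h) t h (hA h)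
    exact (this.2 le_rfl).ne e
  · rintro ⟨x, y, hne, hx, hy⟩
    rcases eq_lo_or_eq_hi x with ⟨h1, e1⟩ | ⟨h1, -⟩
    · rcases eq_lo_or_eq_hi y with ⟨h2, e2⟩ | ⟨h2, -⟩
      · refine absurd ?_ hne
        rw [e1, e2]
        congr 1
        rw [hx, hy]
      · exact hy ▸ h2
    · exact hx ▸ h1

end SplitLine

theorem mk_continuousMap_unitInterval_le (X : Type) [TopologicalSpace X] [SeparableSpace X] :
    #C(X, unitInterval) ≤ 2 ^ ℵ₀ := by
  obtain ⟨D, hD, hd⟩ := exists_countable_dense X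
  have hI : #unitInterval ≤ 𝔠 := (mk_set_le _).trans mk_real.le
  have hinj : Function.Injective fun (f : C(X, unitInterval)) (d : D) => f d := by
    intro f g hfg
    exact ContinuousMap.ext fun x => congrFun
      (f.continuous.ext_on hd g.continuous fun d hd => congrFun hfg ⟨d, hd⟩) x
  calc #C(X, unitInterval) ≤ #(D → unitInterval) := mk_le_of_injective hinj
    _ = #unitInterval ^ #D := by simp
    _ ≤ 𝔠 ^ ℵ₀ := (power_le_power_right hI).trans
        (power_le_power_left continuum_ne_zero hD.le_aleph0)
    _ = 2 ^ ℵ₀ := by rw [continuum_power_aleph0, two_power_aleph0]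

/-- Composing a homeomorphism with the projection of `K_B` gives a continuous map on `K_A` whose
doubly attained values form `B`. -/
theorem mk_homeomorphic_splitLine_le {K A : Set unitInterval} (hK : IsClosed K)
    [SeparableSpace (SplitLine K A)] :
    #{B : Set unitInterval // B ⊆ K ∧ Nonempty (SplitLine K A ≃ₜ SplitLine K B)} ≤ 2 ^ ℵ₀ := by
  refine le_trans ?_ (mk_continuousMap_unitInterval_le (SplitLine K A))
  let f (B : {B : Set unitInterval // B ⊆ K ∧ Nonempty (SplitLine K A ≃ₜ SplitLine K B)}) :
      C(SplitLine K A, unitInterval) :=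
    ⟨fun x => SplitLine.proj (B.2.2.some x),
      (SplitLine.continuous_proj hK B.2.1).comp B.2.2.some.continuous⟩
  have hf (B) (t : unitInterval) : t ∈ B.1 ↔ ∃ x y, x ≠ y ∧ f B x = t ∧ f B y = t := by
    rw [SplitLine.mem_iff_exists_ne B.2.1]
    constructor
    · rintro ⟨x, y, hne, hx, hy⟩
      refine ⟨B.2.2.some.symm x, B.2.2.some.symm y, by simpa using hne, ?_, ?_⟩
      · simpa [f] using hx
      · simpa [f] using hy
    · rintro ⟨x, y, hne, hx, hy⟩
      exact ⟨_, _, B.2.2.some.injective.ne hne, hx, hy⟩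
  refine mk_le_of_injective (f := f) fun B C h => Subtype.ext (Set.ext fun t => ?_)
  rw [hf, hf, h]

theorem exists_embedding_Ioo {h : unitInterval} (hh : h < 1) {κ : Cardinal.{0}}
    (hκ : κ ≤ 2 ^ ℵ₀) : Nonempty (κ.out ↪ Ioo h 1) := by
  rw [← Cardinal.le_def, mk_out]
  rw [two_power_aleph0, ← mk_Ioo_real (show (h : ℝ) < 1 from hh)] at hκ
  refine hκ.trans (mk_le_of_injective (f := fun x : Ioo (h : ℝ) 1 =>
    (⟨⟨x.1, h.2.1.trans x.2.1.le, x.2.2.le⟩, x.2.1, x.2.2⟩ : Ioo h 1)) fun x y hxy => ?_)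
  exact Subtype.ext (congrArg (fun z => (z.1 : ℝ)) hxy)

/-- A family of subsets of `β`, indexed by the subsets of `α`, all of the cardinality of `α`. -/
def fatSubset {α β : Type*} (e : α ⊕ α → β) (B : Set α) : Set β := e '' (range .inl ∪ .inr '' B)

theorem fatSubset_injective {α β : Type*} {e : α ⊕ α → β} (he : Function.Injective e) :
    Function.Injective (fatSubset e) := by
  intro B C h
  have h := he.image_injective h
  ext x
  simpa using (Set.ext_iff.1 h) (.inr x)

theorem mk_fatSubset {α β : Type} {e : α ⊕ α → β} (he : Function.Injective e)
    (hα : ℵ₀ ≤ #α) (B : Set α) : #(fatSubset e B) = #α := by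
  refine le_antisymm (mk_image_le.trans ((mk_set_le _).trans_eq ?_)) ?_
  · rw [mk_sum, lift_id, add_eq_self hα]
  · exact mk_le_of_injective (f := fun a : α => (⟨e (.inl a), _, Or.inl ⟨a, rfl⟩, rfl⟩ :
      fatSubset e B)) fun a b hab => Sum.inl_injective (he (Subtype.ext_iff.1 hab))

theorem exists_family_of_lt {κ : Cardinal.{0}} (hκ : ℵ₀ ≤ κ) (hκc : κ ≤ 2 ^ ℵ₀)
    (hlt : (2 : Cardinal) ^ ℵ₀ < 2 ^ κ) :
    ∃ F : Set (Set unitInterval × Set unitInterval),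
      #F = 2 ^ κ ∧
      (∀ p ∈ F, IsClosed p.1 ∧ p.2 ⊆ p.1 ∧
        CompactSpace (SplitLine p.1 p.2) ∧ SeparableSpace (SplitLine p.1 p.2) ∧
        topWeight (SplitLine p.1 p.2) = κ) ∧
      (∀ p ∈ F, ∀ q ∈ F, p ≠ q →
        IsEmpty (SplitLine p.1 p.2 ≃ₜ SplitLine q.1 q.2)) := by
  obtain ⟨e₀⟩ := exists_embedding_Ioo (h := 0) one_pos hκc
  have hsum : #(κ.out ⊕ κ.out) = #κ.out := by
    rw [mk_sum, lift_id, mk_out, add_eq_self hκ]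
  obtain ⟨e₁⟩ := Cardinal.eq.1 hsum
  have hα : ℵ₀ ≤ #κ.out := by rwa [mk_out]
  let e : κ.out ⊕ κ.out → unitInterval := fun x => e₀ (e₁ x)
  have he : Function.Injective e := Subtype.val_injective.comp (e₀.injective.comp e₁.injective)
  -- One copy of `κ` is always included, which fixes the cardinality; the other encodes the subset.
  let T : Set κ.out → Set unitInterval := fatSubset e
  have hT : Function.Injective T := fatSubset_injective he
  have hTI (B) : T B ⊆ Ioo 0 1 := by
    rintro _ ⟨x, -, rfl⟩
    exact (e₀ (e₁ x)).2
  have hTc (B) : #(T B) = κ := (mk_fatSubset he hα B).trans (mk_out κ)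
  have hIci : Ici (0 : unitInterval) ⊆ univ := subset_univ _
  have hsep (B) : SeparableSpace (SplitLine univ (T B)) :=
    SplitLine.separableSpace isClosed_univ (subset_univ _) hIci (hTI B)
  let r : Setoid (Set κ.out) :=
    { r := fun B C => Nonempty (SplitLine univ (T B) ≃ₜ SplitLine univ (T C))
      iseqv := ⟨fun _ => ⟨.refl _⟩, fun ⟨f⟩ => ⟨f.symm⟩, fun ⟨f⟩ ⟨g⟩ => ⟨f.trans g⟩⟩ }
  have hfib (q : Quotient r) : #{B // Quotient.mk r B = q} ≤ 2 ^ ℵ₀ := by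
    have := hsep q.out
    refine le_trans ?_ (mk_homeomorphic_splitLine_le isClosed_univ (A := T q.out))
    refine mk_le_of_injective (f := fun B => ⟨T B.1, subset_univ _,
      Quotient.exact (q.out_eq.trans B.2.symm)⟩) fun B C h => ?_
    exact Subtype.ext (hT (Subtype.ext_iff.1 h))
  have hq : #(Quotient r) = 2 ^ κ := by
    have hset : #(Set κ.out) = 2 ^ κ := by rw [mk_set, mk_out]
    refine le_antisymm (mk_quotient_le.trans_eq hset) ?_
    by_contra hc
    push Not at hc
    have h1 : #(Set κ.out) ≤ #(Quotient r) * 2 ^ ℵ₀ := by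
      rw [← mk_congr (Equiv.sigmaFiberEquiv (Quotient.mk r)), mk_sigma]
      exact (sum_le_sum _ _ hfib).trans_eq (by simp)
    rw [hset] at h1
    -- Fewer than `2 ^ κ` classes, each of size at most `2 ^ ℵ₀ < 2 ^ κ`, cannot cover `2 ^ κ` sets.
    exact absurd h1 (not_le.2 (mul_lt_of_lt (hκ.trans (cantor κ).le) hc hlt))
  let G : Quotient r → Set unitInterval × Set unitInterval := fun q => (univ, T q.out)
  have hG : Function.Injective G := fun p q h =>
    Quotient.out_injective (hT (Prod.ext_iff.1 h).2)
  refine ⟨range G, (mk_range_eq G hG).trans hq, ?_, ?_⟩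
  · rintro _ ⟨q, rfl⟩
    exact ⟨isClosed_univ, subset_univ _, SplitLine.compactSpace isClosed_univ (subset_univ _),
      hsep _, (SplitLine.topWeight_eq isClosed_univ (subset_univ _)
        (hκ.trans_eq (hTc _).symm)).trans (hTc _)⟩
  · rintro _ ⟨p, rfl⟩ _ ⟨q, rfl⟩ hne
    refine ⟨fun f => hne ?_⟩
    have : Quotient.mk r p.out = Quotient.mk r q.out := Quotient.sound ⟨f⟩
    rw [p.out_eq, q.out_eq] at this
    rw [this]

/-! ### A Cantor–Bendixson invariant -/

section Levels

variable {X Z : Type*} [TopologicalSpace X] [TopologicalSpace Z]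

/-- The complement of the `n`-th Cantor–Bendixson derivative of `X`. -/
def scatteredLevel (X : Type*) [TopologicalSpace X] : ℕ → Set X
  | 0 => ∅
  | n + 1 => {x | ∀ᶠ y in 𝓝[≠] x, y ∈ scatteredLevel X n}

/-- The intersection of the Cantor–Bendixson derivatives of finite order. -/
def finiteKernel (X : Type*) [TopologicalSpace X] : Set X := {x | ∀ k, x ∉ scatteredLevel X k}

/-- The points of `finiteKernel X` near which all points outside of it have rank less than `m`. -/
def shallowKernel (X : Type*) [TopologicalSpace X] (m : ℕ) : Set X :=
  {x | x ∈ finiteKernel X ∧ ∀ᶠ y in 𝓝 x, y ∈ scatteredLevel X m ∨ y ∈ finiteKernel X}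

/-- The set of the `n` such that the ranks of the points outside of `finiteKernel X` near some
point of it have upper limit `n`. -/
def rankSpectrum (X : Type*) [TopologicalSpace X] : Set ℕ :=
  {n | ∃ x, x ∈ shallowKernel X (n + 1) ∧ x ∉ shallowKernel X n}

theorem Topology.IsOpenEmbedding.map_nhdsNE {f : Z → X} (hf : IsOpenEmbedding f) (z : Z) :
    map f (𝓝[≠] z) = 𝓝[≠] (f z) := by
  rw [← hf.map_nhdsWithin_preimage_eq]
  congr 2
  ext w
  simp [hf.injective.eq_iff]

theorem mem_scatteredLevel_of_isOpenEmbedding {f : Z → X} (hf : IsOpenEmbedding f) (n : ℕ) (z : Z) :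
    f z ∈ scatteredLevel X n ↔ z ∈ scatteredLevel Z n := by
  induction n generalizing z with
  | zero => simp [scatteredLevel]
  | succ n ih =>
    simp only [scatteredLevel, mem_ofPred_eq]
    rw [← hf.map_nhdsNE, eventually_map]
    simp only [ih]

theorem mem_finiteKernel_of_isOpenEmbedding {f : Z → X} (hf : IsOpenEmbedding f) (z : Z) :
    f z ∈ finiteKernel X ↔ z ∈ finiteKernel Z := by
  simp only [finiteKernel, mem_ofPred_eq, mem_scatteredLevel_of_isOpenEmbedding hf]

theorem mem_shallowKernel_of_isOpenEmbedding {f : Z → X} (hf : IsOpenEmbedding f) (n : ℕ) (z : Z) :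
    f z ∈ shallowKernel X n ↔ z ∈ shallowKernel Z n := by
  simp only [shallowKernel, mem_ofPred_eq]
  rw [← hf.map_nhds_eq, eventually_map]
  simp only [mem_finiteKernel_of_isOpenEmbedding hf, mem_scatteredLevel_of_isOpenEmbedding hf]

/-- Near a point of the open set `Rᶜ` there are always further points of `Rᶜ`, so by induction no
derivative removes any of them. -/
theorem mem_finiteKernel_of_notMem {R : Set X} (hc : IsClosed (R))
    (hne : ∀ x ∉ R, (𝓝[≠] x).NeBot) {x : X} (hx : x ∉ R) : x ∈ finiteKernel X := by
  intro n
  induction n generalizing x with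
  | zero => simp [scatteredLevel]
  | succ n ih =>
    intro h
    rw [scatteredLevel, mem_ofPred_eq] at h
    have := hne x hx
    have h2 : ∀ᶠ y in 𝓝[≠] x, y ∉ R :=
      mem_nhdsWithin_of_mem_nhds (hc.isOpen_compl.mem_nhds hx)
    obtain ⟨y, h3, h4⟩ := (h.and h2).exists
    exact ih h4 h3

/-- Points off the clopen copy of `Z` have a neighbourhood inside the kernel, hence lie in every
`shallowKernel` and contribute nothing. -/
theorem rankSpectrum_eq_of_isOpenEmbedding {f : Z → X} (hf : IsOpenEmbedding f)
    (hc : IsClosed (range f)) (hne : ∀ x ∉ range f, (𝓝[≠] x).NeBot) :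
    rankSpectrum X = rankSpectrum Z := by
  ext n
  constructor
  · rintro ⟨x, h1, h2⟩
    by_cases hx : x ∈ range f
    · obtain ⟨z, rfl⟩ := hx
      rw [mem_shallowKernel_of_isOpenEmbedding hf] at h1 h2
      exact ⟨z, h1, h2⟩
    · refine absurd ⟨h1.1, ?_⟩ h2
      filter_upwards [hc.isOpen_compl.mem_nhds hx] with y hy
      exact Or.inr (mem_finiteKernel_of_notMem hc hne hy)
  · rintro ⟨z, h1, h2⟩
    refine ⟨f z, ?_, ?_⟩ <;> rwa [mem_shallowKernel_of_isOpenEmbedding hf]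

theorem Homeomorph.rankSpectrum_eq (f : Z ≃ₜ X) : rankSpectrum Z = rankSpectrum X := by
  refine (rankSpectrum_eq_of_isOpenEmbedding f.isOpenEmbedding ?_ fun x hx => ?_).symm
  · simp [f.surjective.range_eq]
  · exact absurd (f.surjective x) hx

section Rank

variable {ρ : X → ℕ∞}

/-- The two hypotheses characterise `ρ` as the Cantor–Bendixson rank, with `⊤` for points that
survive all finite derivatives. -/
theorem mem_scatteredLevel_iff_rank
    (h1 : ∀ x, ρ x ≠ ⊤ → ∀ᶠ y in 𝓝[≠] x, ρ y < ρ x)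
    (h2 : ∀ x, ∀ m : ℕ, (m : ℕ∞) < ρ x → ∃ᶠ y in 𝓝[≠] x, (m : ℕ∞) ≤ ρ y) (n : ℕ) (x : X) :
    x ∈ scatteredLevel X n ↔ ρ x < n := by
  induction n generalizing x with
  | zero => simp [scatteredLevel]
  | succ n ih =>
    simp only [scatteredLevel, mem_ofPred_eq, ih]
    constructor
    · intro h
      by_contra hc
      have hn : (n : ℕ∞) < ρ x :=
        lt_of_lt_of_le (by exact_mod_cast n.lt_succ_self) (not_lt.1 hc)
      obtain ⟨y, h3, h4⟩ := ((h2 x n hn).and_eventually h).exists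
      exact absurd h4 (not_lt.2 h3)
    · intro h
      filter_upwards [h1 x h.ne_top] with y hy
      exact hy.trans_le (Order.le_of_lt_add_one (by exact_mod_cast h))

theorem mem_finiteKernel_iff_rank
    (h1 : ∀ x, ρ x ≠ ⊤ → ∀ᶠ y in 𝓝[≠] x, ρ y < ρ x)
    (h2 : ∀ x, ∀ m : ℕ, (m : ℕ∞) < ρ x → ∃ᶠ y in 𝓝[≠] x, (m : ℕ∞) ≤ ρ y) (x : X) :
    x ∈ finiteKernel X ↔ ρ x = ⊤ := by
  simp only [finiteKernel, mem_ofPred_eq, mem_scatteredLevel_iff_rank h1 h2, not_lt]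
  exact ⟨fun h => ENat.eq_top_iff_forall_ge.2 h, fun h k => h ▸ le_top⟩

theorem mem_shallowKernel_iff_rank
    (h1 : ∀ x, ρ x ≠ ⊤ → ∀ᶠ y in 𝓝[≠] x, ρ y < ρ x)
    (h2 : ∀ x, ∀ m : ℕ, (m : ℕ∞) < ρ x → ∃ᶠ y in 𝓝[≠] x, (m : ℕ∞) ≤ ρ y) (n : ℕ) (x : X) :
    x ∈ shallowKernel X n ↔ ρ x = ⊤ ∧ ∀ᶠ y in 𝓝 x, ρ y < n ∨ ρ y = ⊤ := by
  simp only [shallowKernel, mem_ofPred_eq, mem_finiteKernel_iff_rank h1 h2,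
    mem_scatteredLevel_iff_rank h1 h2]

end Rank

end Levels

/-! ### Cantor sets with prescribed rank spectrum -/

/-- The sequence of pairs of bits with `s` in the first row and `{n}` in the second. -/
def markedPoint (n : ℕ) (s : Finset ℕ) : ℕ → Bool × Bool := fun i => (decide (i ∈ s), decide (i = n))

theorem markedPoint_inj {n m : ℕ} {s t : Finset ℕ} :
    markedPoint n s = markedPoint m t ↔ n = m ∧ s = t := by
  refine ⟨fun h => ⟨?_, ?_⟩, by rintro ⟨rfl, rfl⟩; rfl⟩
  · exact (by simpa [markedPoint] using congrFun h n : (n ∈ s ↔ n ∈ t) ∧ n = m).2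
  · ext i
    have := congrArg Prod.fst (congrFun h i)
    simpa [markedPoint] using this

/-- A Cantor set (the sequences whose first row vanishes) to whose points `markedPoint n ∅`, for
`n ∈ S`, a countable compact set of rank `n` is attached. -/
def markedCantor (S : Set ℕ) : Set (ℕ → Bool × Bool) :=
  {w | (∀ i, (w i).1 = false) ∨
    ∃ n ∈ S, ∃ s : Finset ℕ, s.card ≤ n + 1 ∧ (∀ i ∈ s, n ≤ i) ∧ w = markedPoint n s}

theorem nhds_hasBasis_agree {E : Type*} [TopologicalSpace E] [DiscreteTopology E] (x : ℕ → E) :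
    (𝓝 x).HasBasis (fun _ => True) fun N : ℕ => {y | ∀ i < N, y i = x i} := by
  refine ⟨fun U => ?_⟩
  rw [(PiNat.isTopologicalBasis_cylinders fun _ : ℕ => E).mem_nhds_iff]
  constructor
  · rintro ⟨_, ⟨z, n, rfl⟩, hx, hU⟩
    rw [PiNat.mem_cylinder_iff_eq] at hx
    exact ⟨n, trivial, fun y hy => hU (hx ▸ PiNat.mem_cylinder_iff.2 hy)⟩
  · rintro ⟨n, -, hU⟩
    exact ⟨_, ⟨x, n, rfl⟩, PiNat.self_mem_cylinder _ _, fun y hy => hU (PiNat.mem_cylinder_iff.1 hy)⟩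

theorem eventually_nhds_iff_agree {E : Type*} [TopologicalSpace E] [DiscreteTopology E]
    {Z : Set (ℕ → E)} (x : Z) (p : Z → Prop) :
    (∀ᶠ y in 𝓝 x, p y) ↔ ∃ N : ℕ, ∀ y : Z, (∀ i < N, y.1 i = x.1 i) → p y := by
  rw [nhds_subtype_eq_comap, ((nhds_hasBasis_agree x.1).comap _).eventually_iff]
  simp

theorem isClosed_markedCantor (S : Set ℕ) : IsClosed (markedCantor S) := by
  refine isClosed_of_closure_subset fun w hw => ?_
  rw [mem_closure_iff_nhds_basis (nhds_hasBasis_agree w)] at hw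
  by_cases h0 : ∀ i, (w i).1 = false
  · exact Or.inl h0
  push Not at h0
  obtain ⟨i₀, hi₀⟩ := h0
  rw [ne_eq, Bool.not_eq_false] at hi₀
  -- The condition `n ≤ i` on `s` bounds the marker by `i₀`, so the first `i₀ + 1` entries of the
  -- limit already determine `n`.
  have key (N : ℕ) (hN : i₀ < N) : ∃ n ∈ S, n ≤ i₀ ∧ ∃ s : Finset ℕ, s.card ≤ n + 1 ∧
      (∀ i ∈ s, n ≤ i) ∧ ∀ i < N, w i = markedPoint n s i := by
    obtain ⟨z, h | ⟨n, hn, s, h1, h2, rfl⟩, hz⟩ := hw N trivial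
    · have := h i₀
      rw [hz i₀ hN, hi₀] at this
      cases this
    · refine ⟨n, hn, h2 _ ?_, s, h1, h2, fun i hi => (hz i hi).symm⟩
      have := hz i₀ hN
      rw [← this] at hi₀
      simpa [markedPoint] using hi₀
  obtain ⟨n, hn, hni, s₀, -, -, hs₀⟩ := key (i₀ + 1) (Nat.lt_succ_self _)
  have hw2 : (w n).2 = true := by
    rw [hs₀ n (by omega)]
    simp [markedPoint]
  have key2 (N : ℕ) (hN : i₀ < N) : ∃ s : Finset ℕ, s.card ≤ n + 1 ∧
      (∀ i ∈ s, n ≤ i) ∧ ∀ i < N, w i = markedPoint n s i := by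
    obtain ⟨m, -, hm, s, h1, h2, h3⟩ := key N hN
    have hmn : n = m := by
      rw [h3 n (by omega)] at hw2
      simpa [markedPoint] using hw2
    subst hmn
    exact ⟨s, h1, h2, h3⟩
  have hcard (t : Finset ℕ) (ht : (t : Set ℕ) ⊆ {i | (w i).1 = true}) : t.card ≤ n + 1 := by
    obtain ⟨M, hM⟩ := t.exists_nat_subset_range
    obtain ⟨s, h1, -, h3⟩ := key2 (i₀ + 1 + M) (by omega)
    refine (Finset.card_le_card fun i hi => ?_).trans h1
    have h4 : (w i).1 = true := ht hi
    rw [h3 i (by have := Finset.mem_range.1 (hM hi); omega)] at h4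
    simpa [markedPoint] using h4
  have hfin : {i | (w i).1 = true}.Finite := by
    by_contra hinf
    obtain ⟨t, ht, htc⟩ := Set.Infinite.exists_subset_card_eq hinf (n + 2)
    have := hcard t ht
    omega
  refine Or.inr ⟨n, hn, hfin.toFinset, hcard _ (by simp), fun i hi => ?_, funext fun i => ?_⟩
  · obtain ⟨s, -, h2, h3⟩ := key2 (i₀ + 1 + i) (by omega)
    have h4 : (w i).1 = true := by simpa using hi
    rw [h3 i (by omega)] at h4
    exact h2 i (by simpa [markedPoint] using h4)
  · obtain ⟨s, -, -, h3⟩ := key2 (i₀ + 1 + i) (by omega)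
    have h4 := congrArg Prod.snd (h3 i (by omega))
    refine Prod.ext ?_ ?_
    · simp [markedPoint]
    · simpa [markedPoint] using h4

namespace markedCantor

variable {S : Set ℕ}

open Classical in
/-- The rank of a point of `markedCantor S`. -/
noncomputable def rank (x : markedCantor S) : ℕ∞ :=
  if h : ∃ p : ℕ × Finset ℕ, p.2.Nonempty ∧ x.1 = markedPoint p.1 p.2 then
    ((h.choose.1 + 1 - h.choose.2.card : ℕ) : ℕ∞) else ⊤

theorem rank_of_eq_markedPoint {x : markedCantor S} {n : ℕ} {s : Finset ℕ} (hs : s.Nonempty)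
    (hx : x.1 = markedPoint n s) : rank x = ((n + 1 - s.card : ℕ) : ℕ∞) := by
  have h : ∃ p : ℕ × Finset ℕ, p.2.Nonempty ∧ x.1 = markedPoint p.1 p.2 := ⟨(n, s), hs, hx⟩
  obtain ⟨h1, h2⟩ := markedPoint_inj.1 (h.choose_spec.2.symm.trans hx)
  rw [rank, dif_pos h, h1, h2]

theorem rank_eq_top {x : markedCantor S} (hx : ∀ i, (x.1 i).1 = false) : rank x = ⊤ := by
  rw [rank, dif_neg]
  rintro ⟨p, ⟨i, hi⟩, h⟩
  have := hx i
  rw [h] at this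
  simp [markedPoint, hi] at this

theorem eq_markedPoint_of_fst {x : markedCantor S} {i : ℕ} (hx : (x.1 i).1 = true) :
    ∃ n ∈ S, ∃ s : Finset ℕ, i ∈ s ∧ s.card ≤ n + 1 ∧ (∀ i ∈ s, n ≤ i) ∧
      x.1 = markedPoint n s := by
  rcases x.2 with h | ⟨n, hn, s, h1, h2, h3⟩
  · rw [h i] at hx
    cases hx
  · rw [h3] at hx
    exact ⟨n, hn, s, by simpa [markedPoint] using hx, h1, h2, h3⟩

theorem fst_of_rank_eq_top {x : markedCantor S} (hx : rank x = ⊤) (i : ℕ) : (x.1 i).1 = false := by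
  by_contra h
  rw [Bool.not_eq_false] at h
  obtain ⟨n, -, s, hi, -, -, e⟩ := eq_markedPoint_of_fst h
  rw [rank_of_eq_markedPoint ⟨i, hi⟩ e] at hx
  exact ENat.natCast_ne_top _ hx

theorem eq_markedPoint_of_rank_ne_top {x : markedCantor S} (hx : rank x ≠ ⊤) :
    ∃ n ∈ S, ∃ s : Finset ℕ, s.Nonempty ∧ s.card ≤ n + 1 ∧ (∀ i ∈ s, n ≤ i) ∧
      x.1 = markedPoint n s := by
  by_cases h : ∀ i, (x.1 i).1 = false
  · exact absurd (rank_eq_top h) hx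
  · push Not at h
    obtain ⟨i, hi⟩ := h
    rw [ne_eq, Bool.not_eq_false] at hi
    obtain ⟨n, hn, s, his, h⟩ := eq_markedPoint_of_fst hi
    exact ⟨n, hn, s, ⟨i, his⟩, h⟩

/-- A neighbourhood that sees `n` and all of `s` leaves only points with the same marker and a
larger set, hence of smaller rank. -/
theorem eventually_rank_lt (x : markedCantor S) (hx : rank x ≠ ⊤) :
    ∀ᶠ y in 𝓝[≠] x, rank y < rank x := by
  obtain ⟨n, hn, s, ⟨i, hi⟩, h1, h2, h3⟩ := eq_markedPoint_of_rank_ne_top hx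
  obtain ⟨N, hN⟩ := (insert n s).exists_nat_subset_range
  have hlt : ∀ j ∈ insert n s, j < N := fun j hj => Finset.mem_range.1 (hN hj)
  rw [eventually_nhdsWithin_iff, eventually_nhds_iff_agree]
  refine ⟨N, fun y hy hne => ?_⟩
  have hfst (j) (hj : j ∈ s) : (y.1 j).1 = true := by
    rw [hy j (hlt j (Finset.mem_insert_of_mem hj)), h3]
    simp [markedPoint, hj]
  obtain ⟨m, hm, t, hit, k1, k2, k3⟩ := eq_markedPoint_of_fst (hfst i hi)
  have hmn : n = m := by
    have := hy n (hlt n (Finset.mem_insert_self _ _))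
    rw [h3, k3] at this
    simpa [markedPoint] using congrArg Prod.snd this
  subst hmn
  have hst : s ⊆ t := fun j hj => by
    have := hfst j hj
    rw [k3] at this
    simpa [markedPoint] using this
  have hss : s ⊂ t := hst.ssubset_of_ne fun e => hne (Subtype.ext (by rw [h3, k3, e]))
  have := Finset.card_lt_card hss
  rw [rank_of_eq_markedPoint ⟨i, hi⟩ h3, rank_of_eq_markedPoint ⟨i, hit⟩ k3]
  exact_mod_cast (by omega : n + 1 - t.card < n + 1 - s.card)

theorem frequently_le_rank (x : markedCantor S) (m : ℕ) (hm : (m : ℕ∞) < rank x) :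
    ∃ᶠ y in 𝓝[≠] x, (m : ℕ∞) ≤ rank y := by
  intro h
  rw [eventually_nhdsWithin_iff, eventually_nhds_iff_agree] at h
  obtain ⟨N, hN⟩ := h
  by_cases hx : rank x = ⊤
  · have h0 := fst_of_rank_eq_top hx
    -- Flipping a far bit of the second row stays in the Cantor set, where the rank is `⊤`.
    let w : ℕ → Bool × Bool := Function.update x.1 N (false, !(x.1 N).2)
    have hw (i) : (w i).1 = false := by
      by_cases hi : i = N
      · subst hi; simp [w]
      · simp [w, hi, h0]
    refine hN ⟨w, Or.inl hw⟩ (fun i hi => by simp [w, hi.ne]) (fun e => ?_) ?_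
    · have := congrArg Prod.snd (congrFun (congrArg Subtype.val e) N)
      simp [w] at this
    · beta_reduce
      rw [rank_eq_top (x := ⟨w, Or.inl hw⟩) hw]
      exact le_top
  · obtain ⟨n, hn, s, hs, h1, h2, h3⟩ := eq_markedPoint_of_rank_ne_top hx
    obtain ⟨M, hM⟩ := s.exists_nat_subset_range
    -- Adding one far element to `s` gives a nearby point whose rank is lower by exactly one.
    have hi : N + n + M ∉ s := fun hi => by
      have := Finset.mem_range.1 (hM hi)
      omega
    rw [rank_of_eq_markedPoint hs h3] at hm
    have hm : m < n + 1 - s.card := by exact_mod_cast hm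
    have hc := Finset.card_insert_of_notMem hi
    refine hN ⟨markedPoint n (insert (N + n + M) s), Or.inr ⟨n, hn, _, by omega, fun i hi => ?_, rfl⟩⟩
      (fun i hi => ?_) (fun e => ?_) ?_
    · rcases Finset.mem_insert.1 hi with rfl | hi
      · omega
      · exact h2 i hi
    · have : i ≠ N + n + M := by omega
      rw [h3]
      simp [markedPoint, this]
    · have e := congrArg Subtype.val e
      rw [h3, markedPoint_inj] at e
      exact hi (e.2 ▸ Finset.mem_insert_self _ _)
    · beta_reduce
      rw [rank_of_eq_markedPoint (Finset.insert_nonempty _ _) rfl]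
      exact_mod_cast (by omega : m ≤ n + 1 - (insert (N + n + M) s).card)

theorem exists_rank_eq {k : ℕ} (hk : k ∈ S) (N : ℕ) {w : ℕ → Bool × Bool}
    (hw : ∀ i < N, w i = (false, decide (i = k))) :
    ∃ y : markedCantor S, rank y = k ∧ ∀ i < N, y.1 i = w i := by
  refine ⟨⟨markedPoint k {N + k}, Or.inr ⟨k, hk, _, by simp, by simp, rfl⟩⟩, ?_, fun i hi => ?_⟩
  · rw [rank_of_eq_markedPoint (Finset.singleton_nonempty _) rfl]
    simp
  · have : i ≠ N + k := by omega
    rw [hw i hi]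
    simp [markedPoint, this]

/-- Near `markedPoint n ∅` the finite ranks are at most `n`, and `n` is attained arbitrarily close.
Conversely, a point of rank `n` near a kernel point carries a marker `k ∈ S` with `n ≤ k`; the same
neighbourhood contains a point of rank `k`, so `k ≤ n`. -/
theorem rankSpectrum_eq (S : Set ℕ) : rankSpectrum (markedCantor S) = S := by
  have hsh (n : ℕ) (x : markedCantor S) := mem_shallowKernel_iff_rank (ρ := rank)
    eventually_rank_lt frequently_le_rank n x
  ext n
  simp only [rankSpectrum, mem_ofPred_eq, hsh]
  constructor
  · rintro ⟨x, ⟨hx, h1⟩, h2⟩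
    rw [eventually_nhds_iff_agree] at h1
    obtain ⟨N, hN⟩ := h1
    have h2 : ¬ ∀ᶠ y in 𝓝 x, rank y < n ∨ rank y = ⊤ := fun h => h2 ⟨hx, h⟩
    rw [eventually_nhds_iff_agree] at h2
    push Not at h2
    obtain ⟨y, hy, hny, hyt⟩ := h2 N
    have hyn := (hN y hy).resolve_right hyt
    obtain ⟨k, hk, s, hs, -, -, e⟩ := eq_markedPoint_of_rank_ne_top hyt
    have hs := hs.card_pos
    obtain ⟨z, hz, hzN⟩ := exists_rank_eq hk N (w := x.1) fun i hi => by
      refine Prod.ext (fst_of_rank_eq_top hx i) ?_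
      rw [← hy i hi, e]
      rfl
    have hzk := (hN z hzN).resolve_right (by simp [hz])
    rw [hz] at hzk
    rw [rank_of_eq_markedPoint (Finset.card_pos.1 hs) e] at hny
    have a1 : k < n + 1 := by exact_mod_cast hzk
    have a2 : n ≤ k + 1 - s.card := by exact_mod_cast hny
    obtain rfl : n = k := by omega
    exact hk
  · intro hn
    let x : markedCantor S := ⟨markedPoint n ∅, Or.inl fun i => by simp [markedPoint]⟩
    have hx : rank x = ⊤ := rank_eq_top fun i => by simp [x, markedPoint]
    refine ⟨x, ⟨hx, ?_⟩, fun h => ?_⟩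
    · rw [eventually_nhds_iff_agree]
      refine ⟨n + 1, fun y hy => or_iff_not_imp_right.2 fun hyt => ?_⟩
      obtain ⟨k, hk, s, hs, -, -, e⟩ := eq_markedPoint_of_rank_ne_top hyt
      have hkn : n = k := by
        have := hy n (Nat.lt_succ_self n)
        rw [e] at this
        simpa [markedPoint, x] using congrArg Prod.snd this
      subst hkn
      rw [rank_of_eq_markedPoint hs e]
      have := hs.card_pos
      exact_mod_cast (by omega : n + 1 - s.card < n + 1)
    · have h := h.2
      rw [eventually_nhds_iff_agree] at h
      obtain ⟨N, hN⟩ := h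
      obtain ⟨z, hz, hzN⟩ := exists_rank_eq hn N (w := x.1) fun i _ => by simp [x, markedPoint]
      have := hN z hzN
      simp [hz] at this

end markedCantor

/-! ### Varying `K`: the case `2 ^ κ ≤ 2 ^ ℵ₀` -/

theorem exists_ne_mem_of_isOpen {h t : unitInterval} (h1 : h < 1) (ht : h ≤ t)
    {W : Set unitInterval} (hW : IsOpen W) (htW : t ∈ W) : ∃ s ∈ W, h ≤ s ∧ s ≠ t := by
  rcases (show t ≤ 1 from unitInterval.le_one').lt_or_eq with h2 | h2
  · obtain ⟨u, hu, hW⟩ := exists_Ico_subset_of_mem_nhds (hW.mem_nhds htW) ⟨1, h2⟩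
    obtain ⟨s, hs⟩ := exists_between hu
    exact ⟨s, hW ⟨hs.1.le, hs.2⟩, ht.trans hs.1.le, hs.1.ne'⟩
  · have hht : h < t := h2 ▸ h1
    obtain ⟨u, hu, hW⟩ := exists_Ioc_subset_of_mem_nhds (hW.mem_nhds htW) ⟨h, hht⟩
    obtain ⟨s, hs⟩ := exists_between (max_lt hu hht)
    exact ⟨s, hW ⟨(le_max_left _ _).trans_lt hs.1, hs.2.le⟩, (le_max_right _ _).trans hs.1.le,
      hs.2.ne⟩

theorem SplitLine.neBot_nhdsNE {K A : Set unitInterval} (hK : IsClosed K) (hA : A ⊆ K)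
    {h : unitInterval} (h1 : h < 1) (hhK : Ici h ⊆ K) (hhA : A ⊆ Ioo h 1) {x : SplitLine K A}
    (hx : h ≤ proj x) : (𝓝[≠] x).NeBot := by
  rw [neBot_iff, ne_eq, ← isOpen_singleton_iff_punctured_nhds]
  intro ho
  obtain ⟨W, hW, ⟨t, htW, htK⟩, hWx⟩ :=
    exists_proj_preimage_subset hK hA hhK hhA ho (singleton_nonempty x)
  have ht : lo t htK = x := hWx (show t ∈ W from htW)
  rw [← ht, proj_lo] at hx
  obtain ⟨s, hsW, hhs, hst⟩ := exists_ne_mem_of_isOpen h1 hx hW htW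
  have hs : lo s (hhK hhs) = x := hWx (show s ∈ W from hsW)
  exact hst (congrArg proj (hs.trans ht.symm))

/-- No point below `h` is split, so the part of `K_A` below `h` is a clopen copy of `Z`; the rest
has no isolated points. -/
theorem SplitLine.rankSpectrum_eq {Z : Type} [TopologicalSpace Z] [CompactSpace Z]
    {f : Z → unitInterval} (hf : Continuous f) (hi : Function.Injective f) {h : unitInterval}
    (h1 : h < 1) (hfh : ∀ z, f z < h) {A : Set unitInterval} (hhA : A ⊆ Ioo h 1) :
    rankSpectrum (SplitLine (range f ∪ Ici h) A) = rankSpectrum Z := by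
  have hK : IsClosed (range f ∪ Ici h) := (isCompact_range hf).isClosed.union isClosed_Ici
  have hA : A ⊆ range f ∪ Ici h := fun a ha => Or.inr (hhA ha).1.le
  let g (z : Z) : SplitLine (range f ∪ Ici h) A := lo (f z) (Or.inl ⟨z, rfl⟩)
  have hg : Continuous g := by
    refine (isInducing_coords hK hA).continuous_iff.2 (hf.prodMk (continuous_pi fun a => ?_))
    have : (fun z => decide (g z ≤ lo a.1 (hA a.2))) = fun _ => true := funext fun z =>
      decide_eq_true ((le_iff _ _).2 (Or.inl ((hfh z).trans (hhA a.2).1)))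
    exact this ▸ continuous_const
  have hgi : Function.Injective g := fun x y hxy => hi (congrArg proj hxy)
  have hgc : IsClosedEmbedding g := hg.isClosedEmbedding hgi
  have hr : range g = {x | proj x < h} := by
    ext x
    constructor
    · rintro ⟨z, rfl⟩
      exact hfh z
    · intro hx
      rw [mem_ofPred_eq] at hx
      obtain ⟨hxK, e⟩ := (eq_lo_or_eq_hi x).resolve_right fun hA => hx.not_gt (hhA hA.1).1
      obtain ⟨z, hz⟩ := hxK.resolve_right fun hh => hx.not_ge hh
      refine ⟨z, ?_⟩
      rw [e]
      simp only [g, hz]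
  refine rankSpectrum_eq_of_isOpenEmbedding ⟨hgc.isEmbedding, ?_⟩ hgc.isClosed_range fun x hx => ?_
  · rw [hr]
    exact isOpen_Iio.preimage (continuous_proj hK hA)
  · rw [hr, mem_ofPred_eq, not_lt] at hx
    exact neBot_nhdsNE hK hA h1 subset_union_right hhA hx

theorem exists_continuous_injective_unitInterval :
    ∃ h < (1 : unitInterval), ∃ f : (ℕ → Bool × Bool) → unitInterval,
      Continuous f ∧ Function.Injective f ∧ ∀ w, f w < h := by
  let e : (ℕ → Bool × Bool) → ℕ → Bool :=
    fun w i => if i % 2 = 0 then (w (i / 2)).1 else (w (i / 2)).2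
  have he : Continuous e := by
    refine continuous_pi fun i => ?_
    by_cases hi : i % 2 = 0
    · simp only [e, hi, if_true]; fun_prop
    · simp only [e, hi, if_false]; fun_prop
  have hei : Function.Injective e := fun v w hvw => funext fun i => by
    have h0 := congrFun hvw (2 * i)
    have h1 := congrFun hvw (2 * i + 1)
    have a1 : (2 * i + 1) % 2 = 1 := by omega
    have a2 : (2 * i + 1) / 2 = i := by omega
    simp only [e, a1, a2] at h1
    simp only [e, Nat.mul_mod_right, if_true, Nat.mul_div_cancel_left i two_pos] at h0
    exact Prod.ext h0 (by simpa using h1)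
  have hc (w) := cantorSet_subset_unitInterval (cantorSetHomeomorphNatToBool.symm (e w)).2
  -- The two rows are interleaved and sent to the ternary Cantor set scaled by `1 / 3`, leaving room
  -- below `h = 1 / 2`.
  refine ⟨⟨1 / 2, by norm_num, by norm_num⟩, ?_, fun w =>
    ⟨(cantorSetHomeomorphNatToBool.symm (e w)).1 / 3, ?_, ?_⟩, ?_, ?_, ?_⟩
  · exact Subtype.coe_lt_coe.1 (by norm_num)
  · have := (hc w).1
    positivity
  · have := (hc w).2
    linarith
  · fun_prop
  · intro v w hvw
    have h3 := congrArg Subtype.val hvw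
    refine hei (cantorSetHomeomorphNatToBool.symm.injective (Subtype.ext ?_))
    dsimp only at h3
    linarith
  · intro w
    have := (hc w).2
    refine Subtype.coe_lt_coe.1 ?_
    dsimp only
    linarith

theorem exists_family_of_le {κ : Cardinal.{0}} (hκ : ℵ₀ ≤ κ) (hκc : κ ≤ 2 ^ ℵ₀)
    (hle : (2 : Cardinal) ^ κ ≤ 2 ^ ℵ₀) :
    ∃ F : Set (Set unitInterval × Set unitInterval),
      #F = 2 ^ κ ∧
      (∀ p ∈ F, IsClosed p.1 ∧ p.2 ⊆ p.1 ∧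
        CompactSpace (SplitLine p.1 p.2) ∧ SeparableSpace (SplitLine p.1 p.2) ∧
        topWeight (SplitLine p.1 p.2) = κ) ∧
      (∀ p ∈ F, ∀ q ∈ F, p ≠ q →
        IsEmpty (SplitLine p.1 p.2 ≃ₜ SplitLine q.1 q.2)) := by
  obtain ⟨h, h1, f, hf, hfi, hfh⟩ := exists_continuous_injective_unitInterval
  obtain ⟨e⟩ := exists_embedding_Ioo h1 hκc
  let A : Set unitInterval := range fun x => (e x).1
  have hA : A ⊆ Ioo h 1 := by
    rintro _ ⟨x, rfl⟩
    exact (e x).2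
  have hAc : #A = κ := (mk_range_eq _ (Subtype.val_injective.comp e.injective)).trans (mk_out κ)
  let fS (S : Set ℕ) (z : markedCantor S) : unitInterval := f z.1
  have hfS (S) : Continuous (fS S) := hf.comp continuous_subtype_val
  have hcpt (S) : CompactSpace (markedCantor S) :=
    isCompact_iff_compactSpace.1 (isClosed_markedCantor S).isCompact
  let K (S : Set ℕ) : Set unitInterval := range (fS S) ∪ Ici h
  have hK (S) : IsClosed (K S) := (isCompact_range (hfS S)).isClosed.union isClosed_Ici
  have hAK (S) : A ⊆ K S := fun a ha => Or.inr (hA ha).1.le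
  have hspec (S) : rankSpectrum (SplitLine (K S) A) = S :=
    (SplitLine.rankSpectrum_eq (hfS S) (hfi.comp Subtype.val_injective) h1 (fun z => hfh z.1)
      hA).trans (markedCantor.rankSpectrum_eq S)
  let G (S : Set ℕ) : Set unitInterval × Set unitInterval := (K S, A)
  have hG : Function.Injective G := fun S T hST => by
    rw [← hspec S, ← hspec T, show K S = K T from (Prod.ext_iff.1 hST).1]
  refine ⟨range G, ?_, ?_, ?_⟩
  · rw [mk_range_eq G hG, mk_set, mk_nat]
    -- Here `2 ^ κ = 2 ^ ℵ₀`, so the subsets of `ℕ` are enough.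
    exact le_antisymm (power_le_power_left two_ne_zero hκ) hle
  · rintro _ ⟨S, rfl⟩
    exact ⟨hK S, hAK S, SplitLine.compactSpace (hK S) (hAK S),
      SplitLine.separableSpace (hK S) (hAK S) subset_union_right hA,
      (SplitLine.topWeight_eq (hK S) (hAK S) (hκ.trans_eq hAc.symm)).trans hAc⟩
  · rintro _ ⟨S, rfl⟩ _ ⟨T, rfl⟩ hne
    refine ⟨fun g => hne ?_⟩
    have : S = T := by rw [← hspec S, ← hspec T]; exact g.rankSpectrum_eq
    rw [this]

theorem mainTheorem7 (κ : Cardinal.{0}) (hκ : ℵ₀ ≤ κ) (hκc : κ ≤ 2 ^ ℵ₀) :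
    ∃ F : Set (Set unitInterval × Set unitInterval),
      #F = 2 ^ κ ∧
      (∀ p ∈ F, IsClosed p.1 ∧ p.2 ⊆ p.1 ∧
        CompactSpace (SplitLine p.1 p.2) ∧ SeparableSpace (SplitLine p.1 p.2) ∧
        topWeight (SplitLine p.1 p.2) = κ) ∧
      (∀ p ∈ F, ∀ q ∈ F, p ≠ q →
        IsEmpty (SplitLine p.1 p.2 ≃ₜ SplitLine q.1 q.2)) := by
  rcases lt_or_ge ((2 : Cardinal) ^ ℵ₀) (2 ^ κ) with h | h
  · exact exists_family_of_lt hκ hκc h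
  · exact exists_family_of_le hκ hκc h
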